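/- **Setting.** A stage game $\Gamma$ has a finite player set (of size $N$; the set is also denoted $N$), binary actions $a_i\in\{0,1\}$ and utilities $u_i$; an action profile is identified with the set of players taking action $1$, ordered by inclusion. Write $u_i(a_i,X)$ for the utility of $i$ when the others play $X\subseteq N\setminus\{i\}$ and $u_i^*(X)=\max_{a_i}u_i(a_i,X)$. It is assumed that for every player $i$ and all $X\subsetneq Y\subseteq N\setminus\{i\}$: (single crossing) $u_i(1,X)\ge u_i(0,X)$ implies $u_i(1,Y)\ge u_i(0,Y)$, and likewise with both inequalities strict; (common interests) $u_i^*(X)\le u_i^*(Y)$, and $u_i^*(X)<u_i^*(Y)$ whenever $u_i^*(Y)=u_i(1,Y)$ and $u_i^*(X)=u_i(0,X)$; (deviation-proofness) $u_i(1,Y)\ge u_i(0,X)$ implies $u_i(1,Y)\ge u_i(0,Y)$, and likewise with both inequalities strict; (no dominant action) $u_i(1,N\setminus\{i\})>u_i(0,N\setminus\{i\})$ and $u_i(0,\emptyset)>u_i(1,\emptyset)$. In the *synchronous game* $\Gamma(T)$, $T\ge1$, all players choose actions simultaneously in each of $T$ periods, observing all past actions; action $1$ is irreversible, and payoffs are the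 stage-game payoffs of the last profile. A *design* $(T,\{N_t\}_{t=1}^T)$ consists of $T\ge1$ and an ordered partition of $N$ into blocks (possibly empty); in its *asynchronous game* the players of $N_t$ move simultaneously in period $t$, observing all earlier actions, each player moves once, and payoffs are the stage-game payoffs of the resulting profile. An *MSPNE* is a pure-strategy subgame perfect Nash equilibrium in which every player's action is non-decreasing in the history (histories of equal length carry the product order). $\phi_\Gamma(T)$ is the set of players taking action $1$ in all MSPNE of $\Gamma(T)$. A principal chooses a design. Let $\mathcal P$ be the set of complete transitive preferences over pairs (least MSPNE outcome $X$ of the design, number $T$ of periods) that are weakly increasing in $X$ and strictly decreasing in $T$, and let $\mathcal P_s\subseteq\mathcal P$ be those that are strictly increasing in $X$ (at fixed $T$, $X\subsetneq Y$ implies that $Y$ is strictly preferred). A design is *optimal* for a preference if it is weakly preferred to every design. **Claim.** For every such game $\Gamma$: 1. $\phi_\Gamma(T)$ is the least MSPNE outcome of $\Gamma(T)$ for every $T\ge1$, and the asynchronous game of every design has a least MSPNE outcome. 2. A design $(T,\{N_t\})$ is optimal for some preference in $\mathcal P_s$ if and only if ($T=1$ or $\phi_\Gamma(T)\supsetneq\phi_\Gamma(T-1)$)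 and its least MSPNE outcome equals $\phi_\Gamma(T)$. 3. A design with least MSPNE outcome $X$ is optimal for some preference in $\mathcal P$ if and only if $T=1$ or $X\not\subseteq\phi_\Gamma(T-1)$. If it is optimal for a given preference in $\mathcal P$, then ($T=1$ or $\phi_\Gamma(T)\supsetneq\phi_\Gamma(T-1)$), $X\subseteq\phi_\Gamma(T)$, and $(X,T)$ is indifferent to $(\phi_\Gamma(T),T)$ for that preference. 4. The values of $T$ that occur in designs optimal for some preference in $\mathcal P$ are exactly those with $T=1$ or $\phi_\Gamma(T)\supsetneq\phi_\Gamma(T-1)$. Their number is finite, equals $1+\#\{t\ge1:\phi_\Gamma(t+1)\supsetneq\phi_\Gamma(t)\}$, and is at most $1+\lfloor\sqrt{2N+\tfrac94}-\tfrac32\rfloor$. 5. The bound is tight: for every $N\ge2$ there is such a game with $N$ players for which the number in 4 equals $1+\lfloor\sqrt{2N+\tfrac94}-\tfrac32\rfloor$. -/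

import Mathlib

/-!
Action profiles of a binary-action game with player set `N` are identified with the finite set of
players who take action `1`; the product order on profiles is then inclusion. For `i ∉ X`, the
profile in which `i` takes action `0` (resp. `1`) against the others' profile `X` is `X`
(resp. `insert i X`).
-/

/-- A stage game with binary actions: `Γ.u i X` is the utility of player `i` when exactly the
players in `X` take action `1`. -/
structure StageGame (N : Type*) where
  u : N → Finset N → ℝ

namespace StageGame

variable {N : Type*} [DecidableEq N]

/-- Best payoff of player `i` against the profile `X` of the other players (used for `i ∉ X`). -/
noncomputable def ustar (Γ : StageGame N) (i : N) (X : Finset N) : ℝ :=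
  max (Γ.u i (insert i X)) (Γ.u i X)

/-- Single-crossing condition. -/
def SingleCrossing (Γ : StageGame N) : Prop :=
  ∀ (i : N) (X Y : Finset N), i ∉ Y → X ⊂ Y →
    (Γ.u i X ≤ Γ.u i (insert i X) → Γ.u i Y ≤ Γ.u i (insert i Y)) ∧
    (Γ.u i X < Γ.u i (insert i X) → Γ.u i Y < Γ.u i (insert i Y))

/-- Common interests: the best payoff is non-decreasing in the others' profile, and it strictly
increases when `0` is optimal at the lower profile and `1` is optimal at the higher one. -/
def CommonInterests (Γ : StageGame N) : Prop :=
  ∀ (i : N) (X Y : Finset N), i ∉ Y → X ⊂ Y →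
    Γ.ustar i X ≤ Γ.ustar i Y ∧
    (Γ.ustar i Y = Γ.u i (insert i Y) → Γ.ustar i X = Γ.u i X → Γ.ustar i X < Γ.ustar i Y)

/-- Deviation-proof condition. -/
def DeviationProof (Γ : StageGame N) : Prop :=
  ∀ (i : N) (X Y : Finset N), i ∉ Y → X ⊂ Y →
    (Γ.u i X ≤ Γ.u i (insert i Y) → Γ.u i Y ≤ Γ.u i (insert i Y)) ∧
    (Γ.u i X < Γ.u i (insert i Y) → Γ.u i Y < Γ.u i (insert i Y))

/-- No player has a (weakly) dominant action: `1` is strictly better when all others play `1`,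
and `0` is strictly better when all others play `0`. -/
def Nondegenerate [Fintype N] (Γ : StageGame N) : Prop :=
  ∀ i : N, Γ.u i (Finset.univ.erase i) < Γ.u i Finset.univ ∧ Γ.u i {i} < Γ.u i ∅

/-- The standing assumptions on the stage game. -/
structure IsCoordination [Fintype N] (Γ : StageGame N) : Prop where
  singleCrossing : Γ.SingleCrossing
  commonInterests : Γ.CommonInterests
  deviationProof : Γ.DeviationProof
  nondegenerate : Γ.Nondegenerate

end StageGame

/-- A history: the list of the action profiles chosen in past periods, most recent first. -/
abbrev History (N : Type*) := List (Finset N)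

/-- The rules of a finite-horizon game with observed simultaneous binary moves. After history `h`
the players in `must h` have only action `1` available and those outside `may h` only action `0`.
`outcome h` is the stage-game profile produced by the complete history `h`. -/
structure GameForm (N : Type*) where
  horizon : ℕ
  must : History N → Finset N
  may : History N → Finset N
  outcome : History N → Finset N

namespace GameForm

variable {N : Type*}

/-- The histories that can arise under the rules. -/
inductive Legal (G : GameForm N) : History N → Prop
  | nil : Legal G []
  | cons {h : History N} {m : Finset N} :
      Legal G h → G.must h ⊆ m → m ⊆ G.may h → Legal G (m :: h)

/-- A pure strategy of one player (`true` is action `1`) is admissible if it only takes available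
actions at the legal histories before the end of the game. -/
def Admissible (G : GameForm N) (i : N) (σ : History N → Bool) : Prop :=
  ∀ h, G.Legal h → h.length < G.horizon →
    (i ∈ G.must h → σ h = true) ∧ (i ∉ G.may h → σ h = false)

/-- The history reached from `h` when the strategy profile `s` is followed for `k` periods. -/
def play [Fintype N] (s : N → History N → Bool) : ℕ → History N → History N
  | 0, h => h
  | k + 1, h => play s k ((Finset.univ.filter fun i => s i h = true) :: h)

/-- The stage-game profile that results if `s` is followed from history `h` until the end. -/
def continuation [Fintype N] (G : GameForm N) (s : N → History N → Bool) (h : History N) :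
    Finset N :=
  G.outcome (play s (G.horizon - h.length) h)

/-- Subgame perfect Nash equilibrium in pure strategies: after every legal history, no player can
gain by a unilateral change of strategy. -/
def IsSPNE [Fintype N] [DecidableEq N] (Γ : StageGame N) (G : GameForm N)
    (s : N → History N → Bool) : Prop :=
  (∀ i, G.Admissible i (s i)) ∧
  ∀ h, G.Legal h → h.length < G.horizon → ∀ (i : N) (σ : History N → Bool), G.Admissible i σ →
    Γ.u i (G.continuation (Function.update s i σ) h) ≤ Γ.u i (G.continuation s h)

/-- Monotonicity in history; histories of equal length carry the product order. -/
def IsMonotonic (G : GameForm N) (s : N → History N → Bool) : Prop :=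
  ∀ (i : N) (h₁ h₂ : History N), G.Legal h₁ → G.Legal h₂ → h₁.length < G.horizon →
    List.Forall₂ (fun X Y : Finset N => X ⊆ Y) h₁ h₂ → s i h₁ ≤ s i h₂

/-- The set of outcomes of monotonic subgame perfect Nash equilibria (MSPNE). -/
def mspneOutcomes [Fintype N] [DecidableEq N] (Γ : StageGame N) (G : GameForm N) :
    Set (Finset N) :=
  {X | ∃ s, IsSPNE Γ G s ∧ G.IsMonotonic s ∧ G.continuation s [] = X}

open Classical in
/-- The players who take action `1` in every MSPNE. -/
noncomputable def commonPlayers [Fintype N] [DecidableEq N] (Γ : StageGame N) (G : GameForm N) :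
    Finset N :=
  Finset.univ.filter fun i => ∀ X ∈ mspneOutcomes Γ G, i ∈ X

end GameForm

/-- The synchronous game form with `T` periods: all players move in every period, action `1` is
irreversible, and only the last action profile matters. -/
def syncForm (N : Type*) [Fintype N] (T : ℕ) : GameForm N where
  horizon := T
  must h := h.headD ∅
  may _ := Finset.univ
  outcome h := h.headD ∅

/-- A design: a number of periods `T ≥ 1` and an (ordered) partition of the players into the
blocks `N_1, …, N_T`, some of which may be empty; player `i` belongs to `N_{block i + 1}`. -/
structure Design (N : Type*) where
  periods : ℕ+
  block : N → Fin periods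

/-- The asynchronous game form of a design: in each period the players of the corresponding block
move, and every player moves exactly once. -/
def Design.form {N : Type*} [Fintype N] [DecidableEq N] (D : Design N) : GameForm N where
  horizon := D.periods
  must _ := ∅
  may h := Finset.univ.filter fun i => (D.block i : ℕ) = h.length
  outcome h := h.foldr (· ∪ ·) ∅

namespace StageGame

variable {N : Type*} [Fintype N] [DecidableEq N]

/-- The set `O(Γ(T))` of MSPNE outcomes of the synchronous game with `T` periods. -/
def syncOutcomes (Γ : StageGame N) (T : ℕ) : Set (Finset N) :=
  GameForm.mspneOutcomes Γ (syncForm N T)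

/-- `φ_Γ(T)`: the players who take action `1` in all MSPNE of the synchronous game `Γ(T)`
(meaningful for `T ≥ 1`). -/
noncomputable def phi (Γ : StageGame N) (T : ℕ) : Finset N :=
  GameForm.commonPlayers Γ (syncForm N T)

/-- The set of MSPNE outcomes of the asynchronous game of a design. -/
def asyncOutcomes (Γ : StageGame N) (D : Design N) : Set (Finset N) :=
  GameForm.mspneOutcomes Γ D.form

/-- The players who take action `1` in all MSPNE of the asynchronous game of a design, i.e. its
least MSPNE outcome when there is one. -/
noncomputable def leastMSPNE (Γ : StageGame N) (D : Design N) : Finset N :=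
  GameForm.commonPlayers Γ D.form

end StageGame

/-- The class of admissible preferences of the principal. They are complete and transitive and
depend only on the least MSPNE outcome `X` and on the number of periods `T`; `R p q` means that `p`
is at least as good as `q`. They are weakly increasing in `X` and strictly decreasing in `T`. -/
structure IsPrincipalPref {N : Type*} (R : Finset N × ℕ+ → Finset N × ℕ+ → Prop) : Prop where
  total : ∀ p q, R p q ∨ R q p
  trans : ∀ p q r, R p q → R q r → R p r
  mono : ∀ (X Y : Finset N) (T : ℕ+), X ⊆ Y → R (Y, T) (X, T)
  anti : ∀ (X : Finset N) (T T' : ℕ+), T < T' → ¬ R (X, T') (X, T)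

/-- The principal strictly prefers strictly larger outcomes. -/
def StrictlyIncreasing {N : Type*} (R : Finset N × ℕ+ → Finset N × ℕ+ → Prop) : Prop :=
  ∀ (X Y : Finset N) (T : ℕ+), X ⊂ Y → ¬ R (X, T) (Y, T)

namespace StageGame

variable {N : Type*} [Fintype N] [DecidableEq N]

/-- The design `D` is optimal for the preference `R`, among all designs. -/
def IsOptimal (Γ : StageGame N) (R : Finset N × ℕ+ → Finset N × ℕ+ → Prop) (D : Design N) : Prop :=
  ∀ D' : Design N, R (Γ.leastMSPNE D, D.periods) (Γ.leastMSPNE D', D'.periods)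

/-- The numbers of periods of designs that are optimal for some admissible preference. -/
def candidatePeriods (Γ : StageGame N) : Set ℕ+ :=
  {T | ∃ D : Design N, D.periods = T ∧ ∃ R, IsPrincipalPref R ∧ Γ.IsOptimal R D}

/-- `T = 1`, or `φ_Γ(T)` strictly contains `φ_Γ(T - 1)`. -/
def IsJump (Γ : StageGame N) (T : ℕ+) : Prop :=
  T = 1 ∨ Γ.phi ((T : ℕ) - 1) ⊂ Γ.phi T

end StageGame

/-!
In all the games at hand a history matters only through the set `X` of players committed to action
`1` and the number `r` of periods left, so let `M r` be the set of players who may move in the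
period after which `r` periods remain (everybody in a synchronous game, one block in an asynchronous
one). Call `i` *willing* at `Y` if `1` is the strictly better action of `i` against `Y \ {i}`;
by single crossing, willingness is monotone in `Y`. Call a profile `Y` *stable* for `r + 1` periods
if it is stable for `r` periods and no mover `i ∈ M r` outside `Y` is willing at the least profile
above `Y ∪ {i}` that is stable for `r` periods. Stable profiles are closed under intersection, so
there is a least one, `reach M r X`, above each `X`.

*Least equilibria.* The least MSPNE outcome is `reach M T ∅`. Let every mover join exactly when
belonging to the least stable profile above the current one. Common interests make every player who
joins prefer the target to any smaller outcome, and deviation-proofness makes joining against the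
target unprofitable (`GameForm.deviation_le`). Conversely, the outcome of any MSPNE is stable: a
mover `i` outside the outcome `Z` could join at once, which by monotonicity leads to a stable
`Z' ⊇ Z ∪ {i}`; if `i` were willing at `Z'`, common interests would make this profitable
(`GameForm.stable_continuation`).

*Synchronous and asynchronous games.* Fewer movers mean more stable profiles, so a design with `T`
periods leads to at most `φ(T)`. Some design with `T` periods attains `φ(T)`: as long as a profile
is not stable, there is one new leader to whom the current period can be assigned
(`attainable_reach`). Hence optimality is a matter of comparing the pairs `(φ(T), T)`, and the
preferences needed are lexicographic (`lexPref`).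

*The bound.* If a profile is stable for `t` periods but not for `t + 1`, then `t + 1` periods add at
least `t + 1` players, by induction on `t` (`card_add_le_card_reach`). So the `j`-th jump of `φ` adds
at least `j + 1` players, and `J` jumps need `J (J + 3) / 2 ≤ N`. For tightness, divide the players
into groups of sizes `2, 3, 4, …`, and let a player gain from joining exactly if all the groups up
to the player's own join completely (`groupGame`).
-/

/-! ### Willingness to join -/

namespace StageGame

variable {N : Type*} [DecidableEq N]

/-- Player `i` strictly prefers action `1` when the others play `Y \ {i}`. -/
def Willing (Γ : StageGame N) (i : N) (Y : Finset N) : Prop :=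
  Γ.u i (Y.erase i) < Γ.u i (insert i Y)

theorem Willing.mono {Γ : StageGame N} (hΓ : Γ.SingleCrossing) {i : N} {Y Z : Finset N}
    (h : Γ.Willing i Y) (hYZ : Y ⊆ Z) : Γ.Willing i Z := by
  have key : ∀ X : Finset N, insert i X = insert i (X.erase i) := fun X => by
    ext x; by_cases hx : x = i <;> simp [hx]
  unfold Willing at *
  rw [key] at h ⊢
  rcases (Finset.erase_subset_erase i hYZ).eq_or_ssubset with e | hss
  · rwa [← e]
  · exact (hΓ i _ _ (Finset.notMem_erase i Z) hss).2 h

/-- A player for whom joining at `Y` beats staying out at the smaller profile `X` is willing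
at `Y`. -/
theorem willing_of_lt {Γ : StageGame N} (hΓ : Γ.DeviationProof) {i : N} {X Y : Finset N}
    (hiX : i ∉ X) (hiY : i ∈ Y) (hXY : X ⊆ Y) (h : Γ.u i X < Γ.u i Y) : Γ.Willing i Y := by
  have hsub : X ⊆ Y.erase i := Finset.subset_erase.2 ⟨hXY, hiX⟩
  unfold Willing
  rw [Finset.insert_eq_of_mem hiY]
  rcases hsub.eq_or_ssubset with e | hss
  · rwa [← e]
  · have := (hΓ i _ _ (Finset.notMem_erase i Y) hss).2
    rw [Finset.insert_erase hiY] at this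
    exact this h

/-- A player who is willing at `Y` strictly prefers joining at `Y` to staying out at a smaller
profile. -/
theorem Willing.lt {Γ : StageGame N} (hΓ : Γ.CommonInterests) {i : N} {X Y : Finset N}
    (h : Γ.Willing i Y) (hiX : i ∉ X) (hiY : i ∈ Y) (hXY : X ⊆ Y) : Γ.u i X < Γ.u i Y := by
  have hsub : X ⊆ Y.erase i := Finset.subset_erase.2 ⟨hXY, hiX⟩
  unfold Willing at h
  rw [Finset.insert_eq_of_mem hiY] at h
  rcases hsub.eq_or_ssubset with e | hss
  · rwa [e]
  · have hc := hΓ i _ _ (Finset.notMem_erase i Y) hss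
    have hY : Γ.ustar i (Y.erase i) = Γ.u i Y := by
      rw [ustar, Finset.insert_erase hiY, max_eq_left h.le]
    rw [Finset.insert_erase hiY, hY] at hc
    rcases le_or_gt (Γ.u i (insert i X)) (Γ.u i X) with hle | hgt
    · have hX : Γ.ustar i X = Γ.u i X := max_eq_right hle
      have := hc.2 rfl hX
      rwa [hX] at this
    · have hX : Γ.ustar i X = Γ.u i (insert i X) := max_eq_left hgt.le
      have := hc.1
      rw [hX] at this
      linarith

/-- A player who is willing at `Y` gets at least as much there as at any smaller profile,
whatever the player does in that profile. -/
theorem Willing.le {Γ : StageGame N} (hΓ : Γ.CommonInterests) {i : N} {X Y : Finset N}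
    (h : Γ.Willing i Y) (hiY : i ∈ Y) (hXY : X ⊆ Y) : Γ.u i X ≤ Γ.u i Y := by
  by_cases hiX : i ∈ X
  · rcases (Finset.erase_subset_erase i hXY).eq_or_ssubset with e | hss
    · rw [← Finset.insert_erase hiX, e, Finset.insert_erase hiY]
    · have hc := (hΓ i _ _ (Finset.notMem_erase i Y) hss).1
      unfold Willing at h
      rw [Finset.insert_eq_of_mem hiY] at h
      rw [ustar, ustar, Finset.insert_erase hiY, Finset.insert_erase hiX, max_eq_left h.le] at hc
      exact (le_max_left _ _).trans hc
  · exact (h.lt hΓ hiX hiY hXY).le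

end StageGame

/-! ### Stable sets and the closure operators they define -/

open Classical in
/-- The intersection of all supersets of `X` with the property `p`. -/
noncomputable def Finset.hullOf {N : Type*} [Fintype N] [DecidableEq N] (p : Finset N → Prop)
    (X : Finset N) : Finset N :=
  (Finset.univ.filter fun Y => p Y ∧ X ⊆ Y).inf id

namespace Finset

variable {N : Type*} [Fintype N] [DecidableEq N] {p : Finset N → Prop} {X Y : Finset N}

open Classical in
theorem hullOf_subset (hY : p Y) (h : X ⊆ Y) : hullOf p X ⊆ Y :=
  inf_le (f := id) (mem_filter.2 ⟨mem_univ _, hY, h⟩)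

open Classical in
theorem subset_hullOf (h : ∀ Z, p Z → X ⊆ Z → Y ⊆ Z) : Y ⊆ hullOf p X :=
  Finset.le_inf fun Z hZ => h Z (mem_filter.1 hZ).2.1 (mem_filter.1 hZ).2.2

open Classical in
theorem hullOf_spec (huniv : p univ) (hinter : ∀ Y, p Y → ∀ Z, p Z → p (Y ∩ Z)) (X : Finset N) :
    p (hullOf p X) :=
  inf_induction huniv hinter fun _ hY => (mem_filter.1 hY).2.1

end Finset

namespace StageGame

variable {N : Type*} [Fintype N] [DecidableEq N]

/-- Stable profiles of a game in which the players of `M r` may move in the period after which `r`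
further periods remain. `Γ.Stable M r Y` says that, when `Y` is the current profile and `r` periods
are left, nobody gains from joining in one of these periods, given that the reaction to joining is
the least profile that is stable for the rest of the game. -/
def Stable (Γ : StageGame N) (M : ℕ → Finset N) : ℕ → Finset N → Prop
  | 0, _ => True
  | r + 1, Y => Stable Γ M r Y ∧
      ∀ i ∈ M r, i ∉ Y → ¬ Γ.Willing i (Finset.hullOf (Stable Γ M r) (insert i Y))

/-- The least stable profile above `X` when `r` periods are left; the least continuation outcome
from the profile `X`. -/
noncomputable def reach (Γ : StageGame N) (M : ℕ → Finset N) (r : ℕ) (X : Finset N) : Finset N :=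
  Finset.hullOf (Γ.Stable M r) X

variable {Γ : StageGame N} {M M' : ℕ → Finset N} {r : ℕ} {X Y : Finset N}

theorem subset_reach : X ⊆ Γ.reach M r X :=
  Finset.subset_hullOf fun _ _ h => h

theorem reach_subset (hY : Γ.Stable M r Y) (h : X ⊆ Y) : Γ.reach M r X ⊆ Y :=
  Finset.hullOf_subset hY h

theorem reach_mono (h : X ⊆ Y) : Γ.reach M r X ⊆ Γ.reach M r Y :=
  Finset.subset_hullOf fun _ hZ hYZ => reach_subset hZ (h.trans hYZ)

theorem stable_univ : ∀ r, Γ.Stable M r Finset.univ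
  | 0 => trivial
  | r + 1 => ⟨stable_univ r, fun i _ hi => absurd (Finset.mem_univ i) hi⟩

theorem Stable.inter (hΓ : Γ.SingleCrossing) :
    ∀ {r : ℕ} {X Y : Finset N}, Γ.Stable M r X → Γ.Stable M r Y → Γ.Stable M r (X ∩ Y)
  | 0, _, _, _, _ => trivial
  | r + 1, X, Y, hX, hY => by
    refine ⟨Stable.inter hΓ hX.1 hY.1, fun i hi hXY hw => ?_⟩
    by_cases hiX : i ∈ X
    · have hiY : i ∉ Y := fun h => hXY (Finset.mem_inter.2 ⟨hiX, h⟩)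
      exact hY.2 i hi hiY
        (hw.mono hΓ (reach_mono (Finset.insert_subset_insert _ Finset.inter_subset_right)))
    · exact hX.2 i hi hiX
        (hw.mono hΓ (reach_mono (Finset.insert_subset_insert _ Finset.inter_subset_left)))

theorem stable_reach (hΓ : Γ.SingleCrossing) (r : ℕ) (X : Finset N) :
    Γ.Stable M r (Γ.reach M r X) :=
  Finset.hullOf_spec (stable_univ r) (fun _ ha _ hb => Stable.inter hΓ ha hb) X

theorem Stable.reach_eq (h : Γ.Stable M r X) : Γ.reach M r X = X :=
  (reach_subset h subset_rfl).antisymm subset_reach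

theorem reach_succ_subset (hΓ : Γ.SingleCrossing) : Γ.reach M r X ⊆ Γ.reach M (r + 1) X :=
  reach_subset (stable_reach hΓ (r + 1) X).1 subset_reach

theorem reach_le (hΓ : Γ.SingleCrossing) {r r' : ℕ} (h : r ≤ r') :
    Γ.reach M r X ⊆ Γ.reach M r' X := by
  induction h with
  | refl => exact subset_rfl
  | step _ ih => exact ih.trans (reach_succ_subset hΓ)

/-- A willing mover belongs to every stable set that would make joining pay. -/
theorem Stable.mem_of_willing (hΓ : Γ.SingleCrossing) (hX : Γ.Stable M (r + 1) X) {i : N}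
    (hi : i ∈ M r) (hYX : Y ⊆ X) (hw : Γ.Willing i (Γ.reach M r (insert i Y))) : i ∈ X := by
  by_contra hiX
  exact hX.2 i hi hiX (hw.mono hΓ (reach_mono (Finset.insert_subset_insert _ hYX)))

/-- More movers mean fewer stable sets, hence larger outcomes. -/
theorem Stable.anti_movers (hΓ : Γ.SingleCrossing) (hM : ∀ r, M r ⊆ M' r) :
    ∀ {r : ℕ} {X : Finset N}, Γ.Stable M' r X → Γ.Stable M r X
  | 0, _, _ => trivial
  | _ + 1, _, h => ⟨h.1.anti_movers hΓ hM, fun i hi hiX hw => h.2 i (hM _ hi) hiX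
      (hw.mono hΓ (reach_subset ((stable_reach hΓ _ _).anti_movers hΓ hM) subset_reach))⟩

theorem reach_mono_movers (hΓ : Γ.SingleCrossing) (hM : ∀ r, M r ⊆ M' r) :
    Γ.reach M r X ⊆ Γ.reach M' r X :=
  reach_subset ((stable_reach hΓ _ _).anti_movers hΓ hM) subset_reach

theorem Stable.erase (hΓ : Γ.SingleCrossing) {i : N} :
    ∀ {r : ℕ} {X : Finset N}, Γ.Stable M r X → i ∈ X → ¬ Γ.Willing i X → Γ.Stable M r (X.erase i)
  | 0, _, _, _, _ => trivial
  | r + 1, X, h, hiX, hw => by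
    refine ⟨h.1.erase hΓ hiX hw, fun j hj hjX hwj => ?_⟩
    by_cases hji : j = i
    · subst hji
      rw [Finset.insert_erase hiX] at hwj
      change Γ.Willing j (Γ.reach M r X) at hwj
      rw [h.1.reach_eq] at hwj
      exact hw hwj
    · exact hjX (Finset.mem_erase.2
        ⟨hji, h.mem_of_willing hΓ hj (Finset.erase_subset i X) hwj⟩)

/-- Everyone who joins on the way to the least stable set is willing there: otherwise that player
could be removed. -/
theorem willing_reach (hΓ : Γ.SingleCrossing) {i : N} (hi : i ∈ Γ.reach M r X) (hiX : i ∉ X) :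
    Γ.Willing i (Γ.reach M r X) := by
  by_contra hw
  have := reach_subset ((stable_reach hΓ r X).erase hΓ hi hw)
    (Finset.subset_erase.2 ⟨subset_reach, hiX⟩)
  exact Finset.notMem_erase i _ (this hi)

/-- If all current movers who belong to the target `Γ.reach M (r + 1) X` join at once, the target
is still what the remaining periods lead to. -/
theorem reach_union_movers (hΓ : Γ.SingleCrossing) :
    Γ.reach M r (X ∪ M r ∩ Γ.reach M (r + 1) X) = Γ.reach M (r + 1) X := by
  have hW := stable_reach (M := M) hΓ (r + 1) X
  have hsub : Γ.reach M r (X ∪ M r ∩ Γ.reach M (r + 1) X) ⊆ Γ.reach M (r + 1) X :=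
    reach_subset hW.1 (Finset.union_subset subset_reach Finset.inter_subset_right)
  refine hsub.antisymm (reach_subset ⟨stable_reach hΓ r _, fun i hi hiY hw => ?_⟩
    (Finset.subset_union_left.trans subset_reach))
  exact hiY (subset_reach (Finset.mem_union_right _
    (Finset.mem_inter.2 ⟨hi, hW.mem_of_willing hΓ hi hsub hw⟩)))

end StageGame

/-! ### Least equilibrium outcomes -/

namespace GameForm

variable {N : Type*} [Fintype N] {G : GameForm N} {s : N → History N → Bool}

/-- The profile that `s` prescribes after `h`. -/
def prescribed (s : N → History N → Bool) (h : History N) : Finset N :=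
  Finset.univ.filter fun i => s i h = true

theorem mem_prescribed {h : History N} {i : N} : i ∈ prescribed s h ↔ s i h = true := by
  simp [prescribed]

theorem continuation_end {h : History N} (hh : h.length + 0 = G.horizon) :
    G.continuation s h = G.outcome h := by
  have : G.horizon - h.length = 0 := by omega
  rw [continuation, this, play]

theorem continuation_step {h : History N} {r : ℕ} (hh : h.length + (r + 1) = G.horizon) :
    G.continuation s h = G.continuation s (prescribed s h :: h) := by
  have h₁ : G.horizon - h.length = r + 1 := by omega
  have h₂ : G.horizon - (prescribed s h :: h).length = r := by
    simp only [List.length_cons]; omega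
  rw [continuation, continuation, h₁, h₂, play, prescribed]

/-- Continuations only depend on what the strategies prescribe at the histories still to come. -/
theorem continuation_congr {s' : N → History N → Bool} {k : ℕ}
    (hs : ∀ i h, k ≤ h.length → s i h = s' i h) :
    ∀ (r : ℕ) (h : History N), h.length + r = G.horizon → k ≤ h.length →
      G.continuation s h = G.continuation s' h
  | 0, h, hr, _ => by rw [continuation_end hr, continuation_end hr]
  | r + 1, h, hr, hk => by
    have e : prescribed s h = prescribed s' h := by
      ext i; rw [mem_prescribed, mem_prescribed, hs i h hk]
    rw [continuation_step hr, continuation_step hr, e]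
    exact continuation_congr hs r _ (by simp only [List.length_cons]; omega)
      (by simp only [List.length_cons]; omega)

theorem must_subset_prescribed (hs : ∀ i, G.Admissible i (s i)) {h : History N} (hl : G.Legal h)
    (hh : h.length < G.horizon) : G.must h ⊆ prescribed s h :=
  fun i hi => mem_prescribed.2 ((hs i h hl hh).1 hi)

theorem prescribed_subset_may (hs : ∀ i, G.Admissible i (s i)) {h : History N} (hl : G.Legal h)
    (hh : h.length < G.horizon) : prescribed s h ⊆ G.may h := by
  intro i hi
  by_contra hc
  rw [mem_prescribed, (hs i h hl hh).2 hc] at hi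
  exact absurd hi (by simp)

theorem legal_prescribed (hs : ∀ i, G.Admissible i (s i)) {h : History N} (hl : G.Legal h)
    (hh : h.length < G.horizon) : G.Legal (prescribed s h :: h) :=
  hl.cons (must_subset_prescribed hs hl hh) (prescribed_subset_may hs hl hh)

variable [DecidableEq N]

/-- The common features of synchronous and asynchronous games: the outcome is the union of the
profiles played, the available moves of an uncommitted player depend only on time, and `M r` is the
set of movers in the period after which `r` further periods remain. -/
structure HasMovers (G : GameForm N) (M : ℕ → Finset N) : Prop where
  outcome_nil : G.outcome [] = ∅
  outcome_cons : ∀ h m, G.Legal h → G.must h ⊆ m → m ⊆ G.may h →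
    G.outcome (m :: h) = G.outcome h ∪ m
  must_subset_outcome : ∀ h, G.must h ⊆ G.outcome h
  must_subset_may : ∀ h, G.must h ⊆ G.may h
  may_eq : ∀ h r, h.length + (r + 1) = G.horizon → G.may h = M r
  outcome_mono : ∀ h₁ h₂, List.Forall₂ (fun X Y : Finset N => X ⊆ Y) h₁ h₂ →
    G.outcome h₁ ⊆ G.outcome h₂
  mem_must : ∀ h, G.Legal h → ∀ i ∈ G.may h, i ∈ G.outcome h → i ∈ G.must h

variable {Γ : StageGame N} {M : ℕ → Finset N}

theorem outcome_subset_continuation (hG : G.HasMovers M) (hs : ∀ i, G.Admissible i (s i)) :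
    ∀ (r : ℕ) (h : History N), G.Legal h → h.length + r = G.horizon →
      G.outcome h ⊆ G.continuation s h
  | 0, h, _, hr => by rw [continuation_end hr]
  | r + 1, h, hl, hr => by
    have hh : h.length < G.horizon := by omega
    rw [continuation_step hr]
    refine subset_trans ?_ (outcome_subset_continuation hG hs r _ (legal_prescribed hs hl hh)
      (by simp only [List.length_cons]; omega))
    rw [hG.outcome_cons h _ hl (must_subset_prescribed hs hl hh)
      (prescribed_subset_may hs hl hh)]
    exact Finset.subset_union_left

theorem continuation_mono (hG : G.HasMovers M) (hs : ∀ i, G.Admissible i (s i))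
    (hm : G.IsMonotonic s) :
    ∀ (r : ℕ) (h₁ h₂ : History N), G.Legal h₁ → G.Legal h₂ → h₁.length + r = G.horizon →
      List.Forall₂ (fun X Y : Finset N => X ⊆ Y) h₁ h₂ →
      G.continuation s h₁ ⊆ G.continuation s h₂
  | 0, h₁, h₂, _, _, hr, hle => by
    rw [continuation_end hr, continuation_end (hle.length_eq ▸ hr)]
    exact hG.outcome_mono _ _ hle
  | r + 1, h₁, h₂, hl₁, hl₂, hr, hle => by
    have hr₂ : h₂.length + (r + 1) = G.horizon := hle.length_eq ▸ hr
    have hsub : prescribed s h₁ ⊆ prescribed s h₂ := fun i hi => by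
      have := hm i h₁ h₂ hl₁ hl₂ (by omega) hle
      rw [mem_prescribed] at hi ⊢
      exact Bool.le_iff_imp.1 this hi
    rw [continuation_step hr, continuation_step hr₂]
    exact continuation_mono hG hs hm r _ _ (legal_prescribed hs hl₁ (by omega))
      (legal_prescribed hs hl₂ (by omega)) (by simp only [List.length_cons]; omega)
      (.cons hsub hle)

/-- In an MSPNE, the outcome after any history is stable: if a mover `i` stays out of the outcome,
joining now leads by monotonicity to a larger outcome containing `i`, at which `i` must not be
willing. -/
theorem stable_continuation (hΓ : Γ.SingleCrossing) (hΓ' : Γ.CommonInterests)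
    (hG : G.HasMovers M) (hs : IsSPNE Γ G s) (hm : G.IsMonotonic s) :
    ∀ (r : ℕ) (h : History N), G.Legal h → h.length + r = G.horizon →
      Γ.Stable M r (G.continuation s h)
  | 0, _, _, _ => trivial
  | r + 1, h, hl, hr => by
    have hh : h.length < G.horizon := by omega
    have hr' : ∀ m : Finset N, (m :: h).length + r = G.horizon := fun m => by
      simp only [List.length_cons]; omega
    have hl' := legal_prescribed hs.1 hl hh
    have hmust := must_subset_prescribed hs.1 hl hh
    have hmay := prescribed_subset_may hs.1 hl hh
    refine ⟨?_, fun i hi hiZ hw => ?_⟩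
    · rw [continuation_step hr]
      exact stable_continuation hΓ hΓ' hG hs hm r _ hl' (hr' _)
    have hi' : i ∈ G.may h := by rwa [hG.may_eq h r hr]
    have hl'' : G.Legal (insert i (prescribed s h) :: h) :=
      hl.cons (hmust.trans (Finset.subset_insert _ _)) (Finset.insert_subset hi' hmay)
    -- `σ` joins after `h` and otherwise follows `s i`.
    let σ : History N → Bool := fun g => if g = h then true else s i g
    have hσ : G.Admissible i σ := fun g hg hgl => by
      by_cases e : g = h
      · subst e; simp [σ, hi']
      · simpa [σ, e] using hs.1 i g hg hgl
    have hp : prescribed (Function.update s i σ) h = insert i (prescribed s h) := by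
      ext j
      by_cases e : j = i
      · subst e; simp [mem_prescribed, σ]
      · simp [mem_prescribed, e]
    have hdev : G.continuation (Function.update s i σ) h =
        G.continuation s (insert i (prescribed s h) :: h) := by
      rw [continuation_step hr, hp]
      refine continuation_congr (k := h.length + 1) (fun j g hg => ?_) r _ (hr' _) (by simp)
      by_cases e : j = i
      · subst e
        have : g ≠ h := fun e' => by subst e'; omega
        simp [σ, this]
      · simp [e]
    set Z := G.continuation s h with hZ
    set Z' := G.continuation s (insert i (prescribed s h) :: h) with hZ'
    have hle : Γ.u i Z' ≤ Γ.u i Z := by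
      have := hs.2 h hl hh i σ hσ
      rwa [hdev] at this
    have hZZ' : Z ⊆ Z' := by
      rw [hZ, continuation_step hr]
      exact continuation_mono hG hs.1 hm r _ _ hl' hl'' (hr' _)
        (.cons (Finset.subset_insert _ _) (List.forall₂_same.2 fun _ _ => subset_rfl))
    have hiZ' : i ∈ Z' := by
      refine outcome_subset_continuation hG hs.1 r _ hl'' (hr' _) ?_
      rw [hG.outcome_cons h _ hl (hmust.trans (Finset.subset_insert _ _))
        (Finset.insert_subset hi' hmay)]
      simp
    have hstab : Γ.Stable M r Z' := stable_continuation hΓ hΓ' hG hs hm r _ hl'' (hr' _)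
    have hw' : Γ.Willing i Z' :=
      hw.mono hΓ (StageGame.reach_subset hstab (Finset.insert_subset hiZ' hZZ'))
    exact absurd (hw'.lt hΓ' hiZ hiZ' hZZ') hle.not_gt

open Classical in
/-- The strategy profile that aims at the least stable profile above the current one: a player who
may move joins exactly when belonging to that target. -/
noncomputable def leastStrategy (Γ : StageGame N) (G : GameForm N) (M : ℕ → Finset N) (i : N)
    (h : History N) : Bool :=
  decide (i ∈ G.may h ∧ i ∈ Γ.reach M (G.horizon - h.length) (G.outcome h))

theorem admissible_leastStrategy (hG : G.HasMovers M) (i : N) :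
    G.Admissible i (leastStrategy Γ G M i) := fun h _ _ =>
  ⟨fun hi => decide_eq_true ⟨hG.must_subset_may h hi,
    StageGame.subset_reach (hG.must_subset_outcome h hi)⟩,
    fun hi => decide_eq_false fun hc => hi hc.1⟩

theorem isMonotonic_leastStrategy (hG : G.HasMovers M) :
    G.IsMonotonic (leastStrategy Γ G M) := by
  intro i h₁ h₂ _ _ hh hle
  have hlen := hle.length_eq
  have hmay : G.may h₁ = G.may h₂ := by
    rw [hG.may_eq h₁ (G.horizon - h₁.length - 1) (by omega),
      hG.may_eq h₂ (G.horizon - h₁.length - 1) (by omega)]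
  rw [Bool.le_iff_imp]
  intro h
  have := of_decide_eq_true h
  refine decide_eq_true ⟨hmay ▸ this.1, ?_⟩
  rw [← hlen]
  exact StageGame.reach_mono (hG.outcome_mono _ _ hle) this.2

theorem prescribed_leastStrategy (hG : G.HasMovers M) {r : ℕ} {h : History N}
    (hr : h.length + (r + 1) = G.horizon) :
    prescribed (leastStrategy Γ G M) h = M r ∩ Γ.reach M (r + 1) (G.outcome h) := by
  have e : G.horizon - h.length = r + 1 := by omega
  ext i
  rw [mem_prescribed, leastStrategy, decide_eq_true_iff, Finset.mem_inter, hG.may_eq h r hr, e]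

theorem continuation_leastStrategy (hΓ : Γ.SingleCrossing) (hG : G.HasMovers M) :
    ∀ (r : ℕ) (h : History N), G.Legal h → h.length + r = G.horizon →
      G.continuation (leastStrategy Γ G M) h = Γ.reach M r (G.outcome h)
  | 0, h, _, hr => by
    rw [continuation_end hr, StageGame.Stable.reach_eq (by exact trivial)]
  | r + 1, h, hl, hr => by
    have ha := admissible_leastStrategy (Γ := Γ) hG
    have hh : h.length < G.horizon := by omega
    rw [continuation_step hr, continuation_leastStrategy hΓ hG r _ (legal_prescribed ha hl hh)
      (by simp only [List.length_cons]; omega), hG.outcome_cons h _ hl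
      (must_subset_prescribed ha hl hh) (prescribed_subset_may ha hl hh),
      prescribed_leastStrategy hG hr, StageGame.reach_union_movers hΓ]

/-- Against `leastStrategy`, no deviation, however long, improves on the target. -/
theorem deviation_le (hΓ : Γ.SingleCrossing) (hC : Γ.CommonInterests) (hD : Γ.DeviationProof)
    (hG : G.HasMovers M) {i : N} {σ : History N → Bool} (hσ : G.Admissible i σ) :
    ∀ (r : ℕ) (h : History N), G.Legal h → h.length + r = G.horizon →
      Γ.u i (G.continuation (Function.update (leastStrategy Γ G M) i σ) h) ≤
        Γ.u i (Γ.reach M r (G.outcome h))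
  | 0, h, _, hr => by
    rw [continuation_end hr, StageGame.Stable.reach_eq (by exact trivial)]
  | r + 1, h, hl, hr => by
    set s' := Function.update (leastStrategy Γ G M) i σ with hs'
    have ha : ∀ j, G.Admissible j (s' j) := fun j => by
      by_cases e : j = i
      · subst e; simpa [hs'] using hσ
      · simpa [hs', e] using admissible_leastStrategy hG j
    have hh : h.length < G.horizon := by omega
    rw [continuation_step hr]
    refine (deviation_le hΓ hC hD hG hσ r _ (legal_prescribed ha hl hh)
      (by simp only [List.length_cons]; omega)).trans ?_
    rw [hG.outcome_cons h _ hl (must_subset_prescribed ha hl hh)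
      (prescribed_subset_may ha hl hh)]
    set X := G.outcome h
    set W := Γ.reach M (r + 1) X with hW
    have hWs : Γ.Stable M (r + 1) W := StageGame.stable_reach hΓ (r + 1) X
    have hXm := StageGame.reach_union_movers (M := M) (r := r) (X := X) hΓ
    rw [← hW] at hXm
    -- The other players follow `leastStrategy`.
    have hother : ∀ j, j ≠ i → (j ∈ prescribed s' h ↔ j ∈ M r ∩ W) := fun j hj => by
      rw [← prescribed_leastStrategy hG hr, mem_prescribed, mem_prescribed, hs']
      simp [hj]
    have hmay : prescribed s' h ⊆ M r := by
      rw [← hG.may_eq h r hr]; exact prescribed_subset_may ha hl hh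
    by_cases hi : i ∈ prescribed s' h
    · by_cases hiW : i ∈ W
      · have e : prescribed s' h = M r ∩ W := by
          ext j
          by_cases hj : j = i
          · subst hj; simp [hi, hiW, hmay hi]
          · exact hother j hj
        rw [e, hXm]
      · -- Joining against the target: the reaction is a profile at which `i` is not willing.
        have hsub : X ∪ prescribed s' h ⊆ insert i W := by
          intro j hj
          by_cases e : j = i
          · simp [e]
          · rcases Finset.mem_union.1 hj with hj | hj
            · exact Finset.mem_insert_of_mem (StageGame.subset_reach hj)
            · exact Finset.mem_insert_of_mem (Finset.mem_inter.1 ((hother j e).1 hj)).2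
        have hsup : W ⊆ Γ.reach M r (X ∪ prescribed s' h) := by
          rw [← hXm]
          refine StageGame.reach_mono (Finset.union_subset_union_right fun j hj => ?_)
          by_cases e : j = i
          · exact absurd (e ▸ (Finset.mem_inter.1 hj).2) hiW
          · exact (hother j e).2 hj
        by_contra! hlt
        exact hWs.2 i (hmay hi) hiW ((StageGame.willing_of_lt hD hiW
          (StageGame.subset_reach (Finset.mem_union_right _ hi)) hsup hlt).mono hΓ
          (StageGame.reach_mono hsub))
    · have hsub : Γ.reach M r (X ∪ prescribed s' h) ⊆ W := by
        rw [← hXm]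
        refine StageGame.reach_mono (Finset.union_subset_union_right fun j hj => ?_)
        exact (hother j fun e => hi (e ▸ hj)).1 hj
      by_cases hiW : i ∈ M r ∩ W
      · -- Staying out of the target: `i` is willing there, and the outcome only shrinks.
        have hiX : i ∉ X := fun hiX => hi (must_subset_prescribed ha hl hh
          (hG.mem_must h hl i (by rw [hG.may_eq h r hr]; exact (Finset.mem_inter.1 hiW).1) hiX))
        have hiW' := (Finset.mem_inter.1 hiW).2
        exact (StageGame.willing_reach hΓ hiW' hiX).le hC hiW' hsub
      · have e : prescribed s' h = M r ∩ W := by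
          ext j
          by_cases hj : j = i
          · subst hj; simp only [hi, hiW]
          · exact hother j hj
        rw [e, hXm]

theorem isLeast_mspneOutcomes (hΓ : Γ.IsCoordination) (hG : G.HasMovers M) :
    IsLeast (mspneOutcomes Γ G) (Γ.reach M G.horizon ∅) := by
  have hsc := hΓ.singleCrossing
  refine ⟨⟨leastStrategy Γ G M, ⟨admissible_leastStrategy hG, ?_⟩,
    isMonotonic_leastStrategy hG, ?_⟩, ?_⟩
  · intro h hl hh i σ hσ
    have hr : h.length + (G.horizon - h.length) = G.horizon := by omega
    rw [continuation_leastStrategy hsc hG _ h hl hr]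
    exact deviation_le hsc hΓ.commonInterests hΓ.deviationProof hG hσ _ h hl hr
  · rw [continuation_leastStrategy hsc hG G.horizon [] .nil (by simp), hG.outcome_nil]
  · rintro _ ⟨s, hs, hm, rfl⟩
    exact StageGame.reach_subset (stable_continuation hsc hΓ.commonInterests hG hs hm _ [] .nil
      (by simp)) (Finset.empty_subset _)

theorem commonPlayers_eq {X : Finset N} (h : IsLeast (mspneOutcomes Γ G) X) :
    commonPlayers Γ G = X := by
  ext i
  simp only [commonPlayers, Finset.mem_filter, Finset.mem_univ, true_and]
  exact ⟨fun hi => hi X h.1, fun hi Y hY => h.2 hY hi⟩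

end GameForm

theorem hasMovers_syncForm (N : Type*) [Fintype N] [DecidableEq N] (T : ℕ) :
    (syncForm N T).HasMovers fun _ => Finset.univ where
  outcome_nil := rfl
  outcome_cons h m _ hm _ := (Finset.union_eq_right.2 hm).symm
  must_subset_outcome _ := subset_rfl
  must_subset_may _ := Finset.subset_univ _
  may_eq _ _ _ := rfl
  outcome_mono h₁ h₂ h := by
    cases h with
    | nil => exact subset_rfl
    | cons h _ => exact h
  mem_must _ _ _ _ hi := hi

/-- The players who move in the period of the design after which `r` periods remain. -/
def Design.movers {N : Type*} [Fintype N] (D : Design N) (r : ℕ) : Finset N :=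
  Finset.univ.filter fun i => (D.block i : ℕ) + (r + 1) = D.periods

theorem Design.hasMovers {N : Type*} [Fintype N] [DecidableEq N] (D : Design N) :
    D.form.HasMovers D.movers where
  outcome_nil := rfl
  outcome_cons _ _ _ _ _ := Finset.union_comm _ _
  must_subset_outcome _ := Finset.empty_subset _
  must_subset_may _ := Finset.empty_subset _
  may_eq h r hr := by
    have hr : h.length + (r + 1) = (D.periods : ℕ) := hr
    ext i
    simp only [Design.form, Design.movers, Finset.mem_filter, Finset.mem_univ, true_and]
    omega
  outcome_mono h₁ h₂ h := by
    induction h with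
    | nil => exact subset_rfl
    | cons h _ ih => exact Finset.union_subset_union h ih
  mem_must h hl i hi hi' := by
    have key : ∀ g, D.form.Legal g → ∀ i ∈ D.form.outcome g, (D.block i : ℕ) < g.length := by
      intro g hg
      induction hg with
      | nil => intro i hi; exact absurd hi (Finset.notMem_empty i)
      | @cons g m _ _ hm ih =>
        intro i hi
        rcases Finset.mem_union.1 hi with hi | hi
        · have := (Finset.mem_filter.1 (hm hi)).2
          simp [this]
        · exact (ih i hi).trans (by simp)
    have h₁ := key h hl i hi'
    have h₂ := (Finset.mem_filter.1 hi).2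
    omega

namespace StageGame

variable {N : Type*} [Fintype N] [DecidableEq N] {Γ : StageGame N}

theorem isLeast_sync (hΓ : Γ.IsCoordination) (T : ℕ) :
    IsLeast (Γ.syncOutcomes T) (Γ.reach (fun _ => Finset.univ) T ∅) :=
  GameForm.isLeast_mspneOutcomes hΓ (hasMovers_syncForm N T)

theorem phi_eq_reach (hΓ : Γ.IsCoordination) (T : ℕ) :
    Γ.phi T = Γ.reach (fun _ => Finset.univ) T ∅ :=
  GameForm.commonPlayers_eq (isLeast_sync hΓ T)

theorem isLeast_async (hΓ : Γ.IsCoordination) (D : Design N) :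
    IsLeast (Γ.asyncOutcomes D) (Γ.reach D.movers D.periods ∅) :=
  GameForm.isLeast_mspneOutcomes hΓ D.hasMovers

theorem leastMSPNE_eq_reach (hΓ : Γ.IsCoordination) (D : Design N) :
    Γ.leastMSPNE D = Γ.reach D.movers D.periods ∅ :=
  GameForm.commonPlayers_eq (isLeast_async hΓ D)

theorem phi_mono (hΓ : Γ.IsCoordination) {T T' : ℕ} (h : T ≤ T') : Γ.phi T ⊆ Γ.phi T' := by
  rw [phi_eq_reach hΓ, phi_eq_reach hΓ]
  exact reach_le hΓ.singleCrossing h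

theorem leastMSPNE_subset_phi (hΓ : Γ.IsCoordination) (D : Design N) :
    Γ.leastMSPNE D ⊆ Γ.phi D.periods := by
  rw [leastMSPNE_eq_reach hΓ, phi_eq_reach hΓ]
  exact reach_mono_movers hΓ.singleCrossing fun _ => Finset.subset_univ _

end StageGame

/-! ### Designs that attain the synchronous outcome -/

namespace StageGame

variable {N : Type*} [Fintype N] [DecidableEq N] {Γ : StageGame N}

/-- The outcome `Z` can be reached from `X` within `r` periods even if every player joining in
between moves in one prescribed period only: `b i` is the number of periods remaining after the
period of player `i`. -/
def Attainable (Γ : StageGame N) (r : ℕ) (X Z : Finset N) : Prop :=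
  ∃ b : N → ℕ, (∀ i ∈ Z, i ∉ X → b i < r) ∧
    ∀ M : ℕ → Finset N, (∀ i ∈ Z, i ∉ X → i ∈ M (b i)) → Z ⊆ Γ.reach M r X

theorem attainable_refl (r : ℕ) (X : Finset N) : Γ.Attainable r X X :=
  ⟨fun _ => 0, fun _ hi hi' => absurd hi hi', fun _ _ => subset_reach⟩

theorem Attainable.trans (hΓ : Γ.SingleCrossing) {r : ℕ} {X Y Z : Finset N} (hXY : X ⊆ Y)
    (hYZ : Y ⊆ Z) (h₁ : Γ.Attainable r X Y) (h₂ : Γ.Attainable r Y Z) : Γ.Attainable r X Z := by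
  obtain ⟨b₁, hb₁, hM₁⟩ := h₁
  obtain ⟨b₂, hb₂, hM₂⟩ := h₂
  refine ⟨fun i => if i ∈ Y then b₁ i else b₂ i, fun i hi hiX => ?_, fun M hM => ?_⟩
  · by_cases hiY : i ∈ Y
    · simpa [hiY] using hb₁ i hiY hiX
    · simpa [hiY] using hb₂ i hi hiY
  · have hY : Y ⊆ Γ.reach M r X := hM₁ M fun i hiY hiX => by
      simpa [hiY] using hM i (hYZ hiY) hiX
    refine (hM₂ M fun i hi hiY => ?_).trans (reach_subset (stable_reach hΓ r X) hY)
    simpa [hiY] using hM i hi fun hiX => hiY (hXY hiX)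

theorem Attainable.succ (hΓ : Γ.SingleCrossing) {r : ℕ} {X Z : Finset N}
    (h : Γ.Attainable r X Z) : Γ.Attainable (r + 1) X Z := by
  obtain ⟨b, hb, hM⟩ := h
  exact ⟨b, fun i hi hiX => (hb i hi hiX).trans r.lt_succ_self,
    fun M h => (hM M h).trans (reach_succ_subset hΓ)⟩

/-- An additional first period lets a leader `i` join, provided the reaction makes `i` willing. -/
theorem Attainable.leader (hΓ : Γ.SingleCrossing) {r : ℕ} {X Z : Finset N} {i : N} (hiX : i ∉ X)
    (hZ : insert i X ⊆ Z) (hw : Γ.Willing i Z) (h : Γ.Attainable r (insert i X) Z) :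
    Γ.Attainable (r + 1) X Z := by
  obtain ⟨b, hb, hM⟩ := h
  have hne : ∀ {j}, j ≠ i → j ∉ X → j ∉ insert i X := fun hj hjX h =>
    (Finset.mem_insert.1 h).elim hj hjX
  refine ⟨Function.update b i r, fun j hj hjX => ?_, fun M h => ?_⟩
  · by_cases e : j = i
    · subst e; simp
    · simpa [e] using (hb j hj (hne e hjX)).trans r.lt_succ_self
  · have hZr : Z ⊆ Γ.reach M r (insert i X) := hM M fun j hj hjX => by
      have hji : j ≠ i := fun e => hjX (e ▸ Finset.mem_insert_self j X)
      simpa [hji] using h j hj fun hj' => hjX (Finset.mem_insert_of_mem hj')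
    have hi : i ∈ M r := by simpa using h i (hZ (Finset.mem_insert_self i X)) hiX
    have hs := stable_reach (M := M) hΓ (r + 1) X
    have hiW := hs.mem_of_willing hΓ hi subset_reach (hw.mono hΓ hZr)
    exact hZr.trans (reach_subset hs.1 (Finset.insert_subset hiW subset_reach))

/-- What all players can bring about when they may move in every period can also be brought about
by letting each of them move only once: whenever the current profile is not yet stable, there is a
single new leader to whom a period can be assigned. -/
theorem attainable_reach (hΓ : Γ.SingleCrossing) {M : ℕ → Finset N} :
    ∀ (r : ℕ) (X : Finset N), Γ.Attainable r X (Γ.reach M r X)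
  | 0, X => by
    rw [Stable.reach_eq (by exact trivial)]
    exact attainable_refl 0 X
  | r + 1, X => by
    have hW := stable_reach (M := M) hΓ (r + 1) X
    set W := Γ.reach M (r + 1) X with hWdef
    by_cases hX : Γ.Stable M r X
    · by_cases hX' : Γ.Stable M (r + 1) X
      · rw [hWdef, hX'.reach_eq]
        exact attainable_refl _ X
      · obtain ⟨i, hi, hiX, hw⟩ : ∃ i ∈ M r, i ∉ X ∧ Γ.Willing i (Γ.reach M r (insert i X)) := by
          by_contra! hc
          exact hX' ⟨hX, hc⟩
        have hiW : i ∈ W := hW.mem_of_willing hΓ hi subset_reach hw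
        have hsub : insert i X ⊆ Γ.reach M r (insert i X) := subset_reach
        have hXR : X ⊂ Γ.reach M r (insert i X) :=
          (Finset.ssubset_insert hiX).trans_subset hsub
        have hRW : Γ.reach M r (insert i X) ⊆ W :=
          reach_subset hW.1 (Finset.insert_subset hiW subset_reach)
        have e : Γ.reach M (r + 1) (Γ.reach M r (insert i X)) = W :=
          (reach_subset hW hRW).antisymm (reach_mono hXR.subset)
        have hcard := Finset.card_lt_card (Finset.compl_ssubset_compl.2 hXR)
        have ih := attainable_reach hΓ (M := M) (r + 1) (Γ.reach M r (insert i X))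
        rw [e] at ih
        exact ((attainable_reach hΓ r (insert i X)).leader hΓ hiX hsub hw).trans hΓ
          hXR.subset hRW ih
    · have hXR : X ⊂ Γ.reach M r X := subset_reach.ssubset_of_ne fun e =>
        hX (e ▸ stable_reach hΓ r X)
      have hRW : Γ.reach M r X ⊆ W := reach_succ_subset hΓ
      have e : Γ.reach M (r + 1) (Γ.reach M r X) = W :=
        (reach_subset hW hRW).antisymm (reach_mono hXR.subset)
      have hcard := Finset.card_lt_card (Finset.compl_ssubset_compl.2 hXR)
      have ih := attainable_reach hΓ (M := M) (r + 1) (Γ.reach M r X)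
      rw [e] at ih
      exact ((attainable_reach hΓ r X).succ hΓ).trans hΓ hXR.subset hRW ih
termination_by r X => (r, Xᶜ.card)

theorem exists_design (hΓ : Γ.IsCoordination) (T : ℕ+) :
    ∃ D : Design N, D.periods = T ∧ Γ.leastMSPNE D = Γ.phi T := by
  have hpos := T.pos
  obtain ⟨b, hb, hM⟩ := attainable_reach hΓ.singleCrossing (M := fun _ => Finset.univ) (T : ℕ)
    (∅ : Finset N)
  let D : Design N := ⟨T, fun i => ⟨T - 1 - b i, by omega⟩⟩
  refine ⟨D, rfl, (leastMSPNE_subset_phi hΓ D).antisymm ?_⟩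
  rw [phi_eq_reach hΓ, leastMSPNE_eq_reach hΓ]
  refine hM _ fun i hi hi' => ?_
  have := hb i hi hi'
  simp only [Design.movers, D, Finset.mem_filter, Finset.mem_univ, true_and]
  omega

/-! ### The number of jumps -/

/-- A profile that is stable for `r` periods but not for `r + 1` is enlarged by at least `r + 1`
players: a new leader is willing only because of the reaction to the profile reached with one
period less, and this profile in turn is stable for `r - 1` periods but not for `r`. -/
theorem card_add_le_card_reach (hΓ : Γ.SingleCrossing) {M : ℕ → Finset N}
    (hM : ∀ r i, i ∈ M r) :
    ∀ {r : ℕ} {X : Finset N}, Γ.Stable M r X → ¬ Γ.Stable M (r + 1) X →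
      X.card + (r + 1) ≤ (Γ.reach M (r + 1) X).card
  | 0, X, _, h => Finset.card_lt_card (subset_reach.ssubset_of_ne fun e =>
      h (e ▸ stable_reach hΓ 1 X))
  | r + 1, X, hX, h => by
    have hW := stable_reach (M := M) hΓ (r + 1 + 1) X
    obtain ⟨i, hiX, hw⟩ : ∃ i, i ∉ X ∧ Γ.Willing i (Γ.reach M (r + 1) (insert i X)) := by
      by_contra! hc
      exact h ⟨hX, fun i _ => hc i⟩
    have hnw := hX.2 i (hM r i) hiX
    change ¬ Γ.Willing i (Γ.reach M r (insert i X)) at hnw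
    have hnot : ¬ Γ.Stable M (r + 1) (Γ.reach M r (insert i X)) := fun hs =>
      hnw (hw.mono hΓ (reach_subset hs subset_reach))
    have ih := card_add_le_card_reach hΓ hM (stable_reach hΓ r (insert i X)) hnot
    have hiW := hW.mem_of_willing hΓ (hM _ i) subset_reach hw
    have h₁ := Finset.card_le_card (reach_subset hW.1
      (reach_subset hW.1.1 (Finset.insert_subset hiW subset_reach)))
    have h₂ := Finset.card_le_card (subset_reach (Γ := Γ) (M := M) (r := r) (X := insert i X))
    rw [Finset.card_insert_of_notMem hiX] at h₂
    omega

theorem card_phi_add_le (hΓ : Γ.IsCoordination) {t : ℕ} (h : Γ.phi t ⊂ Γ.phi (t + 1)) :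
    (Γ.phi t).card + (t + 1) ≤ (Γ.phi (t + 1)).card := by
  have hsc := hΓ.singleCrossing
  rw [phi_eq_reach hΓ, phi_eq_reach hΓ] at *
  have hs := stable_reach (M := fun _ => Finset.univ) hsc (t + 1) ∅
  refine (card_add_le_card_reach hsc (fun _ _ => Finset.mem_univ _) (stable_reach hsc t ∅)
    fun hs' => h.2 (reach_subset hs' (Finset.empty_subset _))).trans
    (Finset.card_le_card (reach_subset hs h.1))

/-- The times at which one more period makes the outcome strictly larger. -/
def jumpTimes (Γ : StageGame N) : Set ℕ :=
  {t | 1 ≤ t ∧ Γ.phi t ⊂ Γ.phi (t + 1)}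

theorem jumpTimes_finite (hΓ : Γ.IsCoordination) : Γ.jumpTimes.Finite := by
  refine Set.Finite.of_injOn (f := fun t => (Γ.phi t).card) (t := Set.Iic (Fintype.card N))
    (fun t _ => Finset.card_le_univ _) ?_ (Set.finite_Iic _)
  have key : ∀ t ∈ Γ.jumpTimes, ∀ t', t < t' → (Γ.phi t).card < (Γ.phi t').card :=
    fun t ht t' h => (Finset.card_lt_card ht.2).trans_le (Finset.card_le_card (phi_mono hΓ h))
  intro t ht t' ht' e
  by_contra hne
  rcases lt_or_gt_of_ne hne with h | h
  · exact (key t ht t' h).ne e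
  · exact (key t' ht' t h).ne e.symm

open Classical in
/-- The `j`-th jump occurs at time `j` or later, so it adds at least `j + 1` players. -/
theorem jump_count_le (hΓ : Γ.IsCoordination) (T : ℕ) :
    ((Finset.range T).filter (· ∈ Γ.jumpTimes)).card *
      (((Finset.range T).filter (· ∈ Γ.jumpTimes)).card + 3) ≤ 2 * (Γ.phi T).card := by
  induction T with
  | zero => simp
  | succ T ih =>
    rw [Finset.range_add_one, Finset.filter_insert]
    split_ifs with hT
    · have hle : ((Finset.range T).filter (· ∈ Γ.jumpTimes)).card ≤ T - 1 := by
        rw [← Nat.card_Ico]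
        refine Finset.card_le_card fun t ht => ?_
        have := Finset.mem_filter.1 ht
        exact Finset.mem_Ico.2 ⟨this.2.1, Finset.mem_range.1 this.1⟩
      have hadd := card_phi_add_le hΓ hT.2
      have h1 := hT.1
      rw [Finset.card_insert_of_notMem (by simp)]
      generalize ((Finset.range T).filter (· ∈ Γ.jumpTimes)).card = J at *
      have : J + 1 ≤ T := by omega
      nlinarith
    · exact ih.trans (Nat.mul_le_mul_left 2 (Finset.card_le_card (phi_mono hΓ T.le_succ)))

theorem ncard_jumpTimes_le (hΓ : Γ.IsCoordination) :
    Γ.jumpTimes.ncard ≤ ⌊Real.sqrt (2 * (Fintype.card N : ℝ) + 9 / 4) - 3 / 2⌋₊ := by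
  classical
  obtain ⟨T, hT⟩ := (jumpTimes_finite hΓ).bddAbove
  have e : Γ.jumpTimes = ((Finset.range (T + 1)).filter (· ∈ Γ.jumpTimes) : Finset ℕ) := by
    ext t
    simp only [Finset.coe_filter, Finset.mem_range, Set.mem_ofPred_eq]
    exact ⟨fun h => ⟨Nat.lt_succ_of_le (hT h), h⟩, fun h => h.2⟩
  have h := (jump_count_le hΓ (T + 1)).trans (Nat.mul_le_mul_left 2 (Finset.card_le_univ _))
  rw [e, Set.ncard_coe_finset]
  generalize ((Finset.range (T + 1)).filter (· ∈ Γ.jumpTimes)).card = J at *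
  have h' : (J : ℝ) * (J + 3) ≤ 2 * (Fintype.card N : ℝ) := by exact_mod_cast h
  refine Nat.le_floor ?_
  have := Real.le_sqrt_of_sq_le (x := (J : ℝ) + 3 / 2) (y := 2 * (Fintype.card N : ℝ) + 9 / 4)
    (by nlinarith)
  linarith

/-! ### Optimal designs -/

/-- The lexicographic preference that cares first about whether the outcome satisfies `U`, then
about a small number of periods, and finally about the size of `g`. -/
def lexPref (U : Finset N → Prop) (g : Finset N → ℕ) (p q : Finset N × ℕ+) : Prop :=
  (U q.1 → U p.1) ∧ ((U p.1 → U q.1) → p.2 ≤ q.2 ∧ (p.2 = q.2 → g q.1 ≤ g p.1))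

omit [Fintype N] [DecidableEq N] in
theorem isPrincipalPref_lexPref {U : Finset N → Prop} {g : Finset N → ℕ}
    (hU : ∀ X Y, X ⊆ Y → U X → U Y) (hg : ∀ X Y, X ⊆ Y → g X ≤ g Y) :
    IsPrincipalPref (lexPref U g) where
  total p q := by
    unfold lexPref
    by_cases hp : U p.1 <;> by_cases hq : U q.1 <;> simp only [hp, hq] <;>
      (rcases lt_trichotomy p.2 q.2 with h | h | h
       · simp [h.le, h.ne]
       · simp [h, le_total]
       · simp [h.le, h.ne])
  trans p q r := by
    unfold lexPref
    by_cases hp : U p.1 <;> by_cases hq : U q.1 <;> by_cases hr : U r.1 <;>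
      simp only [hp, hq, hr, forall_const, true_and, imp_self, imp_false, false_and,
        false_imp_iff, and_true, implies_true] <;>
      · rintro ⟨h₁, h₂⟩ ⟨h₃, h₄⟩
        refine ⟨h₁.trans h₃, fun e => ?_⟩
        have e' : p.2 = q.2 := le_antisymm h₁ (h₃.trans e.ge)
        exact (h₄ (e' ▸ e)).trans (h₂ e')
  mono X Y T h := ⟨hU X Y h, fun _ => ⟨le_rfl, fun _ => hg X Y h⟩⟩
  anti X T T' h hR := (hR.2 id).1.not_gt h

omit [Fintype N] [DecidableEq N] in
theorem strictlyIncreasing_lexPref {U : Finset N → Prop} (hU : ∀ X Y, X ⊆ Y → U X → U Y) :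
    StrictlyIncreasing (lexPref U Finset.card) := fun X Y _ h hR =>
  ((hR.2 (hU X Y h.subset)).2 rfl).not_gt (Finset.card_lt_card h)

theorem IsOptimal.eq_one_or (hΓ : Γ.IsCoordination) {D : Design N}
    {R : Finset N × ℕ+ → Finset N × ℕ+ → Prop} (hR : IsPrincipalPref R) (h : Γ.IsOptimal R D) :
    D.periods = 1 ∨ ¬ Γ.leastMSPNE D ⊆ Γ.phi ((D.periods : ℕ) - 1) := by
  refine or_iff_not_imp_left.2 fun hT hsub => ?_
  obtain ⟨T, hTD⟩ := PNat.exists_eq_succ_of_ne_one hT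
  have hTD' : (D.periods : ℕ) - 1 = T := by rw [hTD]; simp
  obtain ⟨D', hD', hX'⟩ := exists_design hΓ T
  have h' := h D'
  rw [hX', hD'] at h'
  rw [hTD'] at hsub
  refine hR.anti (Γ.leastMSPNE D) T D.periods (by rw [hTD]; exact PNat.lt_add_right T 1)
    (hR.trans _ _ _ h' (hR.mono _ _ T hsub))

theorem isJump_of_eq_one_or (hΓ : Γ.IsCoordination) {D : Design N}
    (h : D.periods = 1 ∨ ¬ Γ.leastMSPNE D ⊆ Γ.phi ((D.periods : ℕ) - 1)) :
    Γ.IsJump D.periods :=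
  h.imp_right fun h => ⟨phi_mono hΓ (Nat.sub_le _ _), fun hc =>
    h ((leastMSPNE_subset_phi hΓ D).trans hc)⟩

theorem IsOptimal.pref_phi (hΓ : Γ.IsCoordination) {D : Design N}
    {R : Finset N × ℕ+ → Finset N × ℕ+ → Prop} (h : Γ.IsOptimal R D) :
    R (Γ.leastMSPNE D, D.periods) (Γ.phi D.periods, D.periods) := by
  obtain ⟨D', hD', hX'⟩ := exists_design hΓ D.periods
  have h' := h D'
  rwa [hX', hD'] at h'

/-- A design is optimal for a lexicographic preference whose goal `U` cannot be met earlier. -/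
theorem isOptimal_lexPref (hΓ : Γ.IsCoordination) {D : Design N} {U : Finset N → Prop}
    {g : Finset N → ℕ} (hD : U (Γ.leastMSPNE D))
    (hU : ∀ D' : Design N, U (Γ.leastMSPNE D') → D.periods ≤ D'.periods)
    (hg : ∀ X, X ⊆ Γ.phi D.periods → g X ≤ g (Γ.leastMSPNE D)) :
    Γ.IsOptimal (lexPref U g) D := fun D' =>
  ⟨fun _ => hD, fun h => ⟨hU D' (h hD), fun e =>
    hg _ (by
      rw [show D.periods = D'.periods from e]; exact leastMSPNE_subset_phi hΓ D')⟩⟩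

theorem phi_subset_of_lt (hΓ : Γ.IsCoordination) {D D' : Design N} (h : D'.periods < D.periods) :
    Γ.leastMSPNE D' ⊆ Γ.phi ((D.periods : ℕ) - 1) :=
  (leastMSPNE_subset_phi hΓ D').trans (phi_mono hΓ (Nat.le_sub_one_of_lt h))

theorem exists_strict_optimal_iff (hΓ : Γ.IsCoordination) (D : Design N) :
    (∃ R, IsPrincipalPref R ∧ StrictlyIncreasing R ∧ Γ.IsOptimal R D) ↔
      Γ.IsJump D.periods ∧ Γ.leastMSPNE D = Γ.phi D.periods := by
  constructor
  · rintro ⟨R, hR, hS, hopt⟩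
    refine ⟨isJump_of_eq_one_or hΓ (hopt.eq_one_or hΓ hR), ?_⟩
    by_contra hne
    exact hS _ _ _ ((leastMSPNE_subset_phi hΓ D).ssubset_of_ne hne) (hopt.pref_phi hΓ)
  · rintro ⟨hJ, hX⟩
    have hU : ∀ X Y : Finset N, X ⊆ Y → Γ.phi D.periods ⊆ X → Γ.phi D.periods ⊆ Y :=
      fun X Y h h' => h'.trans h
    refine ⟨lexPref (Γ.phi D.periods ⊆ ·) Finset.card,
      isPrincipalPref_lexPref hU fun _ _ => Finset.card_le_card, strictlyIncreasing_lexPref hU,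
      isOptimal_lexPref hΓ hX.ge (fun D' h => ?_) fun Y hY => hX ▸ Finset.card_le_card hY⟩
    by_contra! hlt
    rcases hJ with h1 | hJ
    · exact absurd hlt (by rw [h1]; exact one_le.not_gt)
    · exact hJ.2 (h.trans (phi_subset_of_lt hΓ hlt))

theorem exists_optimal_iff (hΓ : Γ.IsCoordination) (D : Design N) :
    (∃ R, IsPrincipalPref R ∧ Γ.IsOptimal R D) ↔
      D.periods = 1 ∨ ¬ Γ.leastMSPNE D ⊆ Γ.phi ((D.periods : ℕ) - 1) := by
  constructor
  · rintro ⟨R, hR, hopt⟩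
    exact hopt.eq_one_or hΓ hR
  · rintro (h1 | hX)
    · exact ⟨lexPref (fun _ => True) fun _ => 0,
        isPrincipalPref_lexPref (fun _ _ _ => id) fun _ _ _ => le_rfl,
        isOptimal_lexPref hΓ trivial (fun _ _ => by rw [h1]; exact one_le)
          fun _ _ => le_rfl⟩
    · refine ⟨lexPref (¬ · ⊆ Γ.phi ((D.periods : ℕ) - 1)) fun _ => 0,
        isPrincipalPref_lexPref (fun _ _ h h' hc => h' (h.trans hc)) fun _ _ _ => le_rfl,
        isOptimal_lexPref hΓ hX (fun D' h => ?_) fun _ _ => le_rfl⟩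
      by_contra! hlt
      exact h (phi_subset_of_lt hΓ hlt)

theorem mem_candidatePeriods (hΓ : Γ.IsCoordination) (T : ℕ+) :
    T ∈ Γ.candidatePeriods ↔ Γ.IsJump T := by
  constructor
  · rintro ⟨D, rfl, hD⟩
    exact isJump_of_eq_one_or hΓ ((exists_optimal_iff hΓ D).1 hD)
  · intro hJ
    obtain ⟨D, rfl, hX⟩ := exists_design hΓ T
    exact ⟨D, rfl, (exists_optimal_iff hΓ D).2 (hJ.imp_right fun h => hX ▸ h.2)⟩

theorem candidatePeriods_eq (hΓ : Γ.IsCoordination) :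
    Γ.candidatePeriods = insert 1 (Nat.succPNat '' Γ.jumpTimes) := by
  ext T
  rw [mem_candidatePeriods hΓ, Set.mem_insert_iff, Set.mem_image]
  constructor
  · intro h
    refine or_iff_not_imp_left.2 fun hT => ?_
    obtain ⟨t, rfl⟩ : ∃ t, Nat.succPNat t = T := ⟨T.natPred, PNat.succPNat_natPred T⟩
    refine ⟨t, ⟨Nat.one_le_iff_ne_zero.2 fun e => hT (by rw [e]; rfl), ?_⟩, rfl⟩
    simpa using h.resolve_left hT
  · rintro (h | ⟨t, ht, rfl⟩)
    · exact Or.inl h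
    · exact Or.inr (by simpa using ht.2)

theorem candidatePeriods_finite (hΓ : Γ.IsCoordination) : Γ.candidatePeriods.Finite := by
  rw [candidatePeriods_eq hΓ]
  exact ((jumpTimes_finite hΓ).image _).insert _

theorem ncard_candidatePeriods (hΓ : Γ.IsCoordination) :
    Γ.candidatePeriods.ncard = 1 + Γ.jumpTimes.ncard := by
  rw [candidatePeriods_eq hΓ, Set.ncard_insert_of_notMem _ ((jumpTimes_finite hΓ).image _),
    Set.ncard_image_of_injective _ Nat.succPNat_injective, add_comm]
  rintro ⟨t, ht, e⟩
  have h0 : t = 0 := Nat.succPNat_injective e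
  exact absurd ht.1 (by omega)

end StageGame

/-! ### A game with as many jumps as possible -/

/-- The number `2 + 3 + ⋯ + (j + 1)` of players in the first `j` groups. -/
def groupEnd (j : ℕ) : ℕ := ∑ k ∈ Finset.range j, (k + 2)

theorem groupEnd_succ (j : ℕ) : groupEnd (j + 1) = groupEnd j + (j + 2) :=
  Finset.sum_range_succ _ _

theorem two_mul_groupEnd (j : ℕ) : 2 * groupEnd j = j * (j + 3) := by
  induction j with
  | zero => rfl
  | succ j ih => rw [groupEnd_succ, mul_add, ih]; ring

theorem groupEnd_mono : Monotone groupEnd :=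
  monotone_nat_of_le_succ fun j => by rw [groupEnd_succ]; omega

/-- The players in the first `j` groups. -/
def firstGroups (n j : ℕ) : Finset (Fin n) := Finset.univ.filter fun x => (x : ℕ) < groupEnd j

theorem firstGroups_mono (n : ℕ) : Monotone (firstGroups n) := fun _ _ h _ hx =>
  Finset.mem_filter.2 ⟨Finset.mem_univ _,
    (Finset.mem_filter.1 hx).2.trans_le (groupEnd_mono h)⟩

theorem card_firstGroups {n j : ℕ} (h : groupEnd j ≤ n) : (firstGroups n j).card = groupEnd j := by
  rw [firstGroups, Fin.card_filter_val_lt, min_eq_right h]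

theorem card_firstGroups_sdiff_le (n j : ℕ) :
    (firstGroups n (j + 1) \ firstGroups n j).card ≤ j + 2 := by
  rw [Finset.card_sdiff_of_subset (firstGroups_mono n j.le_succ), firstGroups, firstGroups,
    Fin.card_filter_val_lt, Fin.card_filter_val_lt, groupEnd_succ]
  omega

/-- In this game player `i` wants to join exactly when this completes the first `j` groups for some
`j` such that one of these groups contains `i`. -/
def Completes {n : ℕ} (i : Fin n) (Y : Finset (Fin n)) : Prop :=
  ∃ j, i ∈ firstGroups n j ∧ firstGroups n j ⊆ insert i Y

theorem Completes.mono {n : ℕ} {i : Fin n} {X Y : Finset (Fin n)} (h : Completes i X)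
    (hXY : X ⊆ Y) : Completes i Y :=
  h.imp fun _ h => ⟨h.1, h.2.trans (Finset.insert_subset_insert i hXY)⟩

open Classical in
/-- The group game: action `0` yields `0`; action `1` yields `1` if `Completes` holds and `-1`
otherwise. -/
noncomputable def groupGame (n : ℕ) : StageGame (Fin n) where
  u i Y := if i ∈ Y then if Completes i Y then 1 else -1 else 0

namespace groupGame

variable {n : ℕ}

theorem u_of_notMem {i : Fin n} {Y : Finset (Fin n)} (h : i ∉ Y) : (groupGame n).u i Y = 0 := by
  simp [groupGame, h]

theorem completes_insert {i : Fin n} {Y : Finset (Fin n)} :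
    Completes i (insert i Y) ↔ Completes i Y := by
  simp [Completes]

theorem u_insert_of_completes {i : Fin n} {Y : Finset (Fin n)} (h : Completes i Y) :
    (groupGame n).u i (insert i Y) = 1 := by
  simp [groupGame, completes_insert, h]

theorem u_insert_of_not_completes {i : Fin n} {Y : Finset (Fin n)} (h : ¬ Completes i Y) :
    (groupGame n).u i (insert i Y) = -1 := by
  simp [groupGame, completes_insert, h]

theorem willing_iff {i : Fin n} {Y : Finset (Fin n)} :
    (groupGame n).Willing i Y ↔ Completes i Y := by
  rw [StageGame.Willing, u_of_notMem (Finset.notMem_erase i Y)]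
  by_cases h : Completes i Y
  · simp [u_insert_of_completes h, h]
  · simp only [u_insert_of_not_completes h, h, iff_false]; norm_num

theorem isCoordination (hn : 2 ≤ n) : (groupGame n).IsCoordination where
  singleCrossing i X Y hiY hXY := by
    have hiX : i ∉ X := fun h => hiY (hXY.1 h)
    rw [u_of_notMem hiX, u_of_notMem hiY]
    by_cases hX : Completes i X
    · rw [u_insert_of_completes (hX.mono hXY.1)]; norm_num
    · rw [u_insert_of_not_completes hX]; norm_num
  commonInterests i X Y hiY hXY := by
    have hiX : i ∉ X := fun h => hiY (hXY.1 h)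
    rw [StageGame.ustar, StageGame.ustar, u_of_notMem hiX, u_of_notMem hiY]
    by_cases hY : Completes i Y
    · rw [u_insert_of_completes hY]
      by_cases hX : Completes i X
      · rw [u_insert_of_completes hX]; norm_num
      · rw [u_insert_of_not_completes hX]; norm_num
    · rw [u_insert_of_not_completes hY, u_insert_of_not_completes fun h => hY (h.mono hXY.1)]
      norm_num
  deviationProof i X Y hiY hXY := by
    have hiX : i ∉ X := fun h => hiY (hXY.1 h)
    rw [u_of_notMem hiX, u_of_notMem hiY]
    exact ⟨id, id⟩
  nondegenerate i := by
    constructor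
    · have h : Completes i Finset.univ := by
        refine ⟨n, Finset.mem_filter.2 ⟨Finset.mem_univ _, i.2.trans_le ?_⟩,
          fun x _ => Finset.mem_insert_of_mem (Finset.mem_univ x)⟩
        have := two_mul_groupEnd n
        nlinarith
      have := u_insert_of_completes h
      rw [Finset.insert_eq_of_mem (Finset.mem_univ i)] at this
      rw [u_of_notMem (Finset.notMem_erase i _), this]
      norm_num
    · -- The players `0` and `1` of the first group have to join before anyone wants to.
      have h : ¬ Completes i ∅ := by
        rintro ⟨j, hi, hsub⟩
        have hj : groupEnd 1 ≤ groupEnd j := groupEnd_mono (Nat.one_le_iff_ne_zero.2 fun e => by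
          subst e
          exact Nat.not_lt_zero _ (Finset.mem_filter.1 hi).2)
        have h1 : groupEnd 1 = 2 := rfl
        have hmem : ∀ x : Fin n, (x : ℕ) < 2 → x = i := fun x hx => by
          have := hsub (Finset.mem_filter.2 ⟨Finset.mem_univ x, by omega⟩)
          simpa using this
        have e := (hmem ⟨0, by omega⟩ (by simp)).trans (hmem ⟨1, by omega⟩ (by simp)).symm
        simp at e
      have := u_insert_of_not_completes h
      rw [u_of_notMem (Finset.notMem_empty i)]
      rw [insert_empty_eq] at this
      rw [this]
      norm_num

/-- A profile is stable if every incomplete union of first groups misses more players than there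
are periods left. -/
theorem stable_of_missing {M : ℕ → Finset (Fin n)} :
    ∀ {r : ℕ} {Y : Finset (Fin n)},
      (∀ j, firstGroups n j ⊆ Y ∨ r + 1 ≤ (firstGroups n j \ Y).card) → (groupGame n).Stable M r Y
  | 0, _, _ => trivial
  | r + 1, Y, h => by
    refine ⟨stable_of_missing fun j => (h j).imp_right fun h => by omega, fun i _ hiY hw => ?_⟩
    have hcard : ∀ j, (firstGroups n j \ Y).card ≤ (firstGroups n j \ insert i Y).card + 1 :=
      fun j => by
        rw [Finset.sdiff_insert]
        exact Nat.sub_le_iff_le_add.1 Finset.pred_card_le_card_erase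
    have hs : (groupGame n).Stable M r (insert i Y) := stable_of_missing fun j =>
      (h j).imp (fun h => h.trans (Finset.subset_insert i Y)) fun h => by
        have := hcard j; omega
    change (groupGame n).Willing i ((groupGame n).reach M r (insert i Y)) at hw
    rw [hs.reach_eq, willing_iff, completes_insert] at hw
    obtain ⟨j, hi, hsub⟩ := hw
    rcases h j with h | h
    · exact hiY (h hi)
    · have := hcard j
      rw [Finset.sdiff_eq_empty_iff_subset.2 hsub, Finset.card_empty] at this
      omega

/-- If at most `r` players are missing from the first `j` groups, they all join. -/
theorem firstGroups_subset_reach (hsc : (groupGame n).SingleCrossing) {M : ℕ → Finset (Fin n)}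
    (hM : ∀ r i, i ∈ M r) {j : ℕ} :
    ∀ {r : ℕ} {Y : Finset (Fin n)}, (firstGroups n j \ Y).card ≤ r →
      firstGroups n j ⊆ (groupGame n).reach M r Y
  | 0, Y, h => (Finset.sdiff_eq_empty_iff_subset.1 (Finset.card_eq_zero.1 (Nat.le_zero.1 h))).trans
      StageGame.subset_reach
  | r + 1, Y, h => by
    intro i hi
    by_contra hiW
    have hiY : i ∉ Y := fun h => hiW (StageGame.subset_reach h)
    have hcard : (firstGroups n j \ insert i Y).card < (firstGroups n j \ Y).card :=
      Finset.card_lt_card ((Finset.sdiff_subset_sdiff subset_rfl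
        (Finset.subset_insert i Y)).ssubset_of_ne fun e => by
          have := e ▸ Finset.mem_sdiff.2 ⟨hi, hiY⟩
          simp at this)
    have hsub := firstGroups_subset_reach hsc hM (j := j) (r := r) (Y := insert i Y) (by omega)
    exact hiW ((StageGame.stable_reach hsc (r + 1) Y).mem_of_willing hsc (hM r i)
      StageGame.subset_reach (willing_iff.2 ⟨j, hi, hsub.trans (Finset.subset_insert i _)⟩))

theorem firstGroups_subset_phi (hn : 2 ≤ n) (t : ℕ) :
    firstGroups n t ⊆ (groupGame n).phi (t + 1) := by
  have hsc := (isCoordination hn).singleCrossing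
  rw [StageGame.phi_eq_reach (isCoordination hn)]
  induction t with
  | zero => exact fun x hx => absurd (Finset.mem_filter.1 hx).2 (Nat.not_lt_zero _)
  | succ t ih =>
    have hstable := StageGame.stable_reach (M := fun _ => Finset.univ) hsc (t + 1 + 1) ∅
    have hY := ih.trans (StageGame.reach_succ_subset hsc)
    exact (firstGroups_subset_reach hsc (fun _ _ => Finset.mem_univ _)
      (card_firstGroups_sdiff_le n t)).trans (StageGame.reach_subset hstable hY)

theorem phi_subset_firstGroups (hn : 2 ≤ n) {t : ℕ} (ht : groupEnd (t + 1) ≤ n) :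
    (groupGame n).phi (t + 1) ⊆ firstGroups n t := by
  rw [StageGame.phi_eq_reach (isCoordination hn)]
  refine StageGame.reach_subset (stable_of_missing fun j => ?_) (Finset.empty_subset _)
  rcases le_or_gt j t with hj | hj
  · exact Or.inl (firstGroups_mono n hj)
  · right
    have h := Finset.card_le_card (Finset.sdiff_subset_sdiff
      (firstGroups_mono n (Nat.succ_le_of_lt hj)) (subset_refl (firstGroups n t)))
    rw [Finset.card_sdiff_of_subset (firstGroups_mono n t.le_succ), card_firstGroups ht,
      card_firstGroups ((groupEnd_mono t.le_succ).trans ht), groupEnd_succ] at h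
    omega

theorem ncard_candidatePeriods (hn : 2 ≤ n) :
    (groupGame n).candidatePeriods.ncard =
      1 + ⌊Real.sqrt (2 * (n : ℝ) + 9 / 4) - 3 / 2⌋₊ := by
  have hΓ := isCoordination hn
  rw [StageGame.ncard_candidatePeriods hΓ]
  have hle := StageGame.ncard_jumpTimes_le hΓ
  rw [Fintype.card_fin] at hle
  refine congrArg _ (hle.antisymm ?_)
  set J := ⌊Real.sqrt (2 * (n : ℝ) + 9 / 4) - 3 / 2⌋₊ with hJ
  have hJn : groupEnd J ≤ n := by
    have hn' : (2 : ℝ) ≤ n := by exact_mod_cast hn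
    have h0 : (3 / 2 : ℝ) ≤ Real.sqrt (2 * (n : ℝ) + 9 / 4) :=
      Real.le_sqrt_of_sq_le (by nlinarith)
    have h1 : (J : ℝ) ≤ Real.sqrt (2 * (n : ℝ) + 9 / 4) - 3 / 2 := Nat.floor_le (by linarith)
    have h2 := Real.sq_sqrt (show (0 : ℝ) ≤ 2 * (n : ℝ) + 9 / 4 by linarith)
    have h3 : (J : ℝ) * (J + 3) ≤ 2 * n := by
      have : (0 : ℝ) ≤ J := Nat.cast_nonneg J
      nlinarith
    have h4 : J * (J + 3) ≤ 2 * n := by exact_mod_cast h3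
    have := two_mul_groupEnd J
    omega
  have hsub : Set.Icc 1 J ⊆ (groupGame n).jumpTimes := by
    rintro t ⟨h1, ht⟩
    refine ⟨h1, (StageGame.phi_mono hΓ t.le_succ).ssubset_of_ne fun e => ?_⟩
    obtain ⟨t, rfl⟩ := Nat.exists_eq_add_of_le' h1
    have htn : groupEnd (t + 1) ≤ n := (groupEnd_mono ht).trans hJn
    have hsub := (firstGroups_subset_phi hn (t + 1)).trans
      (e.ge.trans (phi_subset_firstGroups hn htn))
    have := Finset.card_le_card hsub
    rw [card_firstGroups htn, card_firstGroups ((groupEnd_mono t.le_succ).trans htn),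
      groupEnd_succ] at this
    omega
  calc J = (Set.Icc 1 J).ncard := by
        rw [← Finset.coe_Icc, Set.ncard_coe_finset, Nat.card_Icc, Nat.add_sub_cancel]
    _ ≤ _ := Set.ncard_le_ncard hsub (StageGame.jumpTimes_finite hΓ)

end groupGame

theorem mainTheorem12 :
    (∀ (N : Type*) [Fintype N] [DecidableEq N] (Γ : StageGame N), Γ.IsCoordination →
      -- the least MSPNE outcomes exist
      (∀ T : ℕ+, IsLeast (Γ.syncOutcomes T) (Γ.phi T)) ∧
      (∀ D : Design N, IsLeast (Γ.asyncOutcomes D) (Γ.leastMSPNE D)) ∧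
      -- optimality for some strictly increasing preference of the class
      (∀ D : Design N,
        (∃ R, IsPrincipalPref R ∧ StrictlyIncreasing R ∧ Γ.IsOptimal R D) ↔
          Γ.IsJump D.periods ∧ Γ.leastMSPNE D = Γ.phi D.periods) ∧
      -- optimality for some preference of the class, indifference to larger outcomes allowed
      (∀ D : Design N,
        (∃ R, IsPrincipalPref R ∧ Γ.IsOptimal R D) ↔
          D.periods = 1 ∨ ¬ Γ.leastMSPNE D ⊆ Γ.phi ((D.periods : ℕ) - 1)) ∧
      (∀ (D : Design N) (R : Finset N × ℕ+ → Finset N × ℕ+ → Prop),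
        IsPrincipalPref R → Γ.IsOptimal R D →
          Γ.IsJump D.periods ∧ Γ.leastMSPNE D ⊆ Γ.phi D.periods ∧
            R (Γ.leastMSPNE D, D.periods) (Γ.phi D.periods, D.periods)) ∧
      -- the possible numbers of periods of optimal designs
      (∀ T : ℕ+, T ∈ Γ.candidatePeriods ↔ Γ.IsJump T) ∧
      Γ.candidatePeriods.Finite ∧
      Γ.candidatePeriods.ncard = 1 + {t : ℕ | 1 ≤ t ∧ Γ.phi t ⊂ Γ.phi (t + 1)}.ncard ∧
      Γ.candidatePeriods.ncard ≤
        1 + ⌊Real.sqrt (2 * (Fintype.card N : ℝ) + 9 / 4) - 3 / 2⌋₊) ∧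
    -- tightness
    (∀ n : ℕ, 2 ≤ n → ∃ Γ : StageGame (Fin n), Γ.IsCoordination ∧
      Γ.candidatePeriods.ncard = 1 + ⌊Real.sqrt (2 * (n : ℝ) + 9 / 4) - 3 / 2⌋₊) := by
  refine ⟨fun N _ _ Γ hΓ => ⟨fun T => ?_, fun D => ?_, StageGame.exists_strict_optimal_iff hΓ,
    StageGame.exists_optimal_iff hΓ, fun D R hR hopt => ?_, StageGame.mem_candidatePeriods hΓ,
    StageGame.candidatePeriods_finite hΓ, StageGame.ncard_candidatePeriods hΓ, ?_⟩,
    fun n hn => ⟨groupGame n, groupGame.isCoordination hn, groupGame.ncard_candidatePeriods hn⟩⟩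
  · rw [StageGame.phi_eq_reach hΓ]
    exact StageGame.isLeast_sync hΓ T
  · rw [StageGame.leastMSPNE_eq_reach hΓ]
    exact StageGame.isLeast_async hΓ D
  · exact ⟨StageGame.isJump_of_eq_one_or hΓ (hopt.eq_one_or hΓ hR),
      StageGame.leastMSPNE_subset_phi hΓ D, hopt.pref_phi hΓ⟩
  · rw [StageGame.ncard_candidatePeriods hΓ]
    exact Nat.add_le_add_left (StageGame.ncard_jumpTimes_le hΓ) 1
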